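/- For a word $w$ in $k$ variables (an element of the free group on $k$ generators, $k\ge 0$) and a group $G$, let $w\{G\}=\{w(g_1,\dots,g_k)\mid g_i\in G\}$ be the set of $w$-values in $G$ and let $w(G)=\langle w\{G\}\rangle$ be the verbal subgroup, i.e. the subgroup generated by $w\{G\}$. The word $w$ is called strongly concise in a class $\mathfrak{C}$ of profinite groups if, for every $G\in\mathfrak{C}$ with $|w\{G\}|<2^{\aleph_0}$, the subgroup $w(G)$ is finite. A profinite group $G$ is called linear if there are a field $F$ and an integer $n\ge 0$ such that $G$, as an abstract group, embeds in $\mathrm{GL}_n(F)$. Corollary 1.2. Every word is strongly concise in the class of profinite linear groups. That is, for every word $w$ and every profinite linear group $G$, if $|w\{G\}|<2^{\aleph_0}$, then $w(G)$ is finite. -/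

import Mathlib

open scoped MatrixGroups

universe u v

/-- The set `w{G}` of values `w(g₁, …, g_k)`, `g_i ∈ G`, in the group `G` of a word `w` in `k`
variables, i.e. of an element of the free group on `k` generators. -/
def wordValues {k : ℕ} (w : FreeGroup (Fin k)) (G : Type*) [Group G] : Set G :=
  Set.range fun g : Fin k → G => FreeGroup.lift g w

/-- The verbal subgroup `w(G)`: the (abstract) subgroup of `G` generated by `w{G}`. -/
def verbalSubgroup {k : ℕ} (w : FreeGroup (Fin k)) (G : Type*) [Group G] : Subgroup G :=
  Subgroup.closure (wordValues w G)

/-- A word `w` is strongly concise in a class `C` of profinite groups if, for every `G` in `C`,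
the verbal subgroup `w(G)` is finite whenever `|w{G}| < 2^ℵ₀`. -/
def StronglyConcise {k : ℕ} (w : FreeGroup (Fin k)) (C : Set ProfiniteGrp.{u}) : Prop :=
  ∀ G ∈ C, Cardinal.mk (wordValues w G) < Cardinal.continuum → Finite (verbalSubgroup w G)

/-- A group is linear if it embeds, as an abstract group, in `GL_n(F)` for some field `F` and
some natural number `n`. -/
def IsLinearGroup (G : Type u) [Group G] : Prop :=
  ∃ (F : Type v) (_ : Field F) (n : ℕ) (φ : G →* GL (Fin n) F), Function.Injective φ

/-- The class of profinite groups that are linear over some field, of any characteristic.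
The embedding is not required to respect the topology. -/
def profiniteLinearGroups : Set ProfiniteGrp.{u} :=
  {G | IsLinearGroup.{u, v} G}

/-! Topology supplies an open marginal subgroup; what remains is about abstract linear groups. A
nonempty compact set with fewer than continuum many points has an isolated point, so every box of
arguments contains a smaller box on which `w` is constant. Regular functions on a linear group form
a Noetherian ring, so some open normal `N` is minimal for the Zariski topology: every smaller open
normal subgroup is dense in it. Constancy therefore spreads, one variable at a time, to all cosets
of `N`, and `N` is marginal.

A marginal subgroup centralises the verbal subgroup, and the arguments of `w` matter only modulo
`N`. Hence `G` may be replaced by a finitely generated `Γ`, where `w(Γ)` is finitely generated and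
central-by-finite, so finite once torsion. In a finite image of `Γ`, a prime not dividing `|Γ : N|`
divides no order of an element of the verbal subgroup (`IsMarginal.not_dvd_orderOf`). Torsion
follows by reducing matrices over a finitely generated ring modulo well-chosen maximal ideals: in
characteristic 0 one containing such a prime, in characteristic `p` one sending a supposed
transcendental eigenvalue to a root of unity of such a prime order. -/

/-! ### Isolated word values and boxes of constancy. -/

open Cardinal in
-- A Cantor scheme without a metric: pieces need not shrink to points, but compactness puts a point
-- on every branch, and two branches are disjoint from their first difference on.
theorem Perfect.continuum_le_mk {X : Type u} [TopologicalSpace X] [CompactSpace X] [T2Space X]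
    {C : Set X} (hC : Perfect C) (hne : C.Nonempty) : 𝔠 ≤ #C := by
  classical
  have split : ∀ D : {D : Set X // Perfect D ∧ D.Nonempty}, ∃ f : Bool → {D : Set X // Perfect D ∧ D.Nonempty},
      (∀ b, (f b).1 ⊆ D.1) ∧ Disjoint (f true).1 (f false).1 := by
    rintro ⟨D, hD, hn⟩
    obtain ⟨C₀, C₁, ⟨h0, h0n, h0s⟩, ⟨h1, h1n, h1s⟩, hd⟩ := hD.splitting hn
    exact ⟨fun b => cond b ⟨C₀, h0, h0n⟩ ⟨C₁, h1, h1n⟩, by rintro (_ | _) <;> assumption, hd⟩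
  choose f hfs hfd using split
  let T : (ℕ → Bool) → ℕ → {D : Set X // Perfect D ∧ D.Nonempty} := fun x n =>
    Nat.rec ⟨C, hC, hne⟩ (fun m D => f D (x m)) n
  have hT : ∀ x n, T x (n + 1) = f (T x n) (x n) := fun _ _ => rfl
  have hI : ∀ x, (⋂ n, (T x n).1).Nonempty := fun x =>
    IsCompact.nonempty_iInter_of_sequence_nonempty_isCompact_isClosed _
      (fun n => by rw [hT]; exact hfs _ _) (fun n => (T x n).2.2)
      (T x 0).2.1.closed.isCompact (fun n => (T x n).2.1.closed)
  choose g hg using hI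
  have hg' : ∀ x n, g x ∈ (T x n).1 := fun x n => Set.mem_iInter.1 (hg x) n
  have hinj : Function.Injective g := by
    intro x y hxy
    by_contra hne'
    have hex : ∃ n, x n ≠ y n := Function.ne_iff.1 hne'
    have hlt : ∀ m ≤ Nat.find hex, T x m = T y m := by
      intro m
      induction m with
      | zero => intro _; rfl
      | succ m ih =>
        intro hm
        rw [hT, hT, ih (by omega), not_not.1 (Nat.find_min hex (Nat.lt_of_succ_le hm))]
    have h1 := hg' x (Nat.find hex + 1)
    have h2 := hg' y (Nat.find hex + 1)
    have hsp := Nat.find_spec hex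
    rw [hT, hlt _ le_rfl, hxy] at h1
    rw [hT] at h2
    have hd := hfd (T y (Nat.find hex))
    cases hx : x (Nat.find hex) <;> cases hy : y (Nat.find hex) <;> rw [hx] at h1 <;> rw [hy] at h2
    · exact hsp (hx.trans hy.symm)
    · exact Set.disjoint_left.1 hd h2 h1
    · exact Set.disjoint_left.1 hd h1 h2
    · exact hsp (hx.trans hy.symm)
  let g' : (ℕ → Bool) → C := fun x => ⟨g x, hg' x 0⟩
  have hinj' : Function.Injective g' := fun x y h => hinj (congrArg Subtype.val h)
  have := Cardinal.lift_mk_le_lift_mk_of_injective hinj'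
  simpa using this

/-- A nonempty compact set of fewer than continuum many points has an isolated point. -/
theorem IsCompact.exists_isolated {X : Type u} [TopologicalSpace X] [CompactSpace X] [T2Space X]
    {C : Set X} (hC : IsCompact C) (hne : C.Nonempty) (hcard : Cardinal.mk C < Cardinal.continuum) :
    ∃ y ∈ C, ∃ V : Set X, IsOpen V ∧ y ∈ V ∧ V ∩ C ⊆ {y} := by
  by_contra! H
  refine not_le.2 hcard (Perfect.continuum_le_mk ⟨hC.isClosed, fun y hy => ?_⟩ hne)
  rw [accPt_iff_nhds]
  intro U hU
  obtain ⟨V, hVU, hV, hyV⟩ := mem_nhds_iff.1 hU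
  obtain ⟨z, hz, hzy⟩ := Set.not_subset.1 (H y hy V hV hyV)
  exact ⟨z, ⟨hVU hz.1, hz.2⟩, hzy⟩

/-- A subgroup `N` is marginal for `w` if multiplying the arguments by elements of `N` does not
change the value of `w`. -/
def IsMarginal {k : ℕ} (w : FreeGroup (Fin k)) {G : Type*} [Group G] (N : Subgroup G) : Prop :=
  ∀ g n : Fin k → G, (∀ i, n i ∈ N) → FreeGroup.lift (g * n) w = FreeGroup.lift g w

theorem FreeGroup.continuous_lift {α : Type*} {G : Type*} [Group G] [TopologicalSpace G]
    [IsTopologicalGroup G] (w : FreeGroup α) :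
    Continuous fun g : α → G => FreeGroup.lift g w := by
  induction w using FreeGroup.induction_on with
  | C1 => simpa using continuous_const
  | of x => simpa using continuous_apply x
  | inv_of x h => simpa [Pi.inv_def] using (continuous_apply x).inv
  | mul x y hx hy => simpa [Pi.mul_def] using hx.mul hy

/-- If `w` has fewer than continuum many values, then every box contains a smaller box on which
`w` is constant. -/
theorem exists_constant_box {k : ℕ} (w : FreeGroup (Fin k)) {G : Type u} [Group G]
    [TopologicalSpace G] [IsTopologicalGroup G] [CompactSpace G] [TotallyDisconnectedSpace G]
    [T2Space G]
    (hw : Cardinal.mk (wordValues w G) < Cardinal.continuum) (N : OpenNormalSubgroup G)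
    (g : Fin k → G) :
    ∃ m : Fin k → G, (∀ i, m i ∈ N) ∧ ∃ N' : OpenNormalSubgroup G, N' ≤ N ∧
      ∀ n : Fin k → G, (∀ i, n i ∈ N') →
        FreeGroup.lift (g * m * n) w = FreeGroup.lift (g * m) w := by
  have hcont : Continuous fun m : Fin k → G => FreeGroup.lift (g * m) w :=
    (FreeGroup.continuous_lift w).comp (continuous_const.mul continuous_id)
  set B : Set (Fin k → G) := Set.univ.pi fun _ => (N : Set G) with hB
  have hBo : IsOpen B := isOpen_set_pi Set.finite_univ fun _ _ => N.isOpen'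
  have hBc : IsCompact B := isCompact_univ_pi fun _ => N.toOpenSubgroup.isClosed.isCompact
  have hsub : (fun m : Fin k → G => FreeGroup.lift (g * m) w) '' B ⊆ wordValues w G := by
    rintro _ ⟨m, -, rfl⟩
    exact ⟨g * m, rfl⟩
  -- An isolated value `y` of `w` on the box is attained on an open set of arguments.
  obtain ⟨y, ⟨m₀, hm₀, hy⟩, V, hV, hyV, hVs⟩ := (hBc.image hcont).exists_isolated
    ⟨_, 1, fun i _ => N.one_mem', rfl⟩ ((Cardinal.mk_le_mk_of_subset hsub).trans_lt hw)
  set W : Set (Fin k → G) := B ∩ (fun m : Fin k → G => FreeGroup.lift (g * m) w) ⁻¹' V with hW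
  have hWo : IsOpen W := hBo.inter (hV.preimage hcont)
  have hmW : m₀ ∈ W := ⟨hm₀, by simpa [hy] using hyV⟩
  have hWc : ∀ m ∈ W, FreeGroup.lift (g * m) w = y := fun m hm =>
    hVs ⟨hm.2, m, hm.1, rfl⟩
  have hW1 : IsOpen ((fun n : Fin k → G => m₀ * n) ⁻¹' W) :=
    hWo.preimage (continuous_const.mul continuous_id)
  obtain ⟨U, hU, hUW⟩ := isOpen_pi_iff'.1 hW1 1 (by simpa using hmW)
  have hUo : IsOpen (⋂ i, U i) := isOpen_iInter_of_finite fun i => (hU i).1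
  obtain ⟨N₁, hN₁⟩ := ProfiniteGrp.exist_openNormalSubgroup_sub_open_nhds_of_one hUo
    (Set.mem_iInter.2 fun i => (hU i).2)
  refine ⟨m₀, fun i => hm₀ i trivial, N₁ ⊓ N, inf_le_right, fun n hn => ?_⟩
  rw [hWc m₀ hmW, mul_assoc]
  refine hWc _ (hUW fun i _ => ?_)
  exact Set.mem_iInter.1 (hN₁ (hn i).1) i

/-! ### Regular functions and Zariski density. -/

section Regular

variable {G : Type*} [Group G] {L : Type*} [Field L] {n : ℕ}

/-- The algebra of functions on `G` that are polynomials in the entries of `φ g` and `φ g⁻¹`. -/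
def regularFunctions (φ : G →* GL (Fin n) L) : Subalgebra L (G → L) :=
  Algebra.adjoin L
    ((Set.range fun (ij : Fin n × Fin n) (g : G) => (φ g : Matrix (Fin n) (Fin n) L) ij.1 ij.2) ∪
      Set.range fun (ij : Fin n × Fin n) (g : G) => (φ g⁻¹ : Matrix (Fin n) (Fin n) L) ij.1 ij.2)

instance (φ : G →* GL (Fin n) L) : IsNoetherianRing (regularFunctions φ) := by
  have h := (Set.finite_range fun (ij : Fin n × Fin n) (g : G) =>
    (φ g : Matrix (Fin n) (Fin n) L) ij.1 ij.2).union
      (Set.finite_range fun (ij : Fin n × Fin n) (g : G) =>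
        (φ g⁻¹ : Matrix (Fin n) (Fin n) L) ij.1 ij.2)
  have := (Subalgebra.fg_iff_finiteType (regularFunctions φ)).1
    (Subalgebra.fg_def.2 ⟨_, h, rfl⟩)
  exact Algebra.FiniteType.isNoetherianRing L _

/-- The ideal of regular functions that vanish on `S`. -/
def vanishingIdealOn (φ : G →* GL (Fin n) L) (S : Set G) : Ideal (regularFunctions φ) where
  carrier := {f | ∀ x ∈ S, f.1 x = 0}
  add_mem' hf hg x hx := by simp [hf x hx, hg x hx]
  zero_mem' x _ := rfl
  smul_mem' c f hf x hx := by simp [hf x hx]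

/-- A self-map of `G` is regular if the matrix entries of `f x` and of its inverse are regular. -/
def IsRegularMap (φ : G →* GL (Fin n) L) (f : G → G) : Prop :=
  ∀ i j, (fun x => (φ (f x) : Matrix (Fin n) (Fin n) L) i j) ∈ regularFunctions φ ∧
    (fun x => (φ (f x)⁻¹ : Matrix (Fin n) (Fin n) L) i j) ∈ regularFunctions φ

theorem IsRegularMap.id (φ : G →* GL (Fin n) L) : IsRegularMap φ fun x => x := fun i j =>
  ⟨Algebra.subset_adjoin (Or.inl ⟨(i, j), rfl⟩), Algebra.subset_adjoin (Or.inr ⟨(i, j), rfl⟩)⟩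

theorem IsRegularMap.const (φ : G →* GL (Fin n) L) (c : G) : IsRegularMap φ fun _ => c :=
  fun _ _ => ⟨(regularFunctions φ).algebraMap_mem _, (regularFunctions φ).algebraMap_mem _⟩

theorem IsRegularMap.inv {φ : G →* GL (Fin n) L} {f : G → G} (hf : IsRegularMap φ f) :
    IsRegularMap φ fun x => (f x)⁻¹ :=
  fun i j => ⟨(hf i j).2, by simpa using (hf i j).1⟩

theorem IsRegularMap.mul {φ : G →* GL (Fin n) L} {f g : G → G} (hf : IsRegularMap φ f)
    (hg : IsRegularMap φ g) : IsRegularMap φ fun x => f x * g x := by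
  intro i j
  constructor
  · have : (fun x => (φ (f x * g x) : Matrix (Fin n) (Fin n) L) i j) =
        ∑ l, (fun x => (φ (f x) : Matrix (Fin n) (Fin n) L) i l) *
          (fun x => (φ (g x) : Matrix (Fin n) (Fin n) L) l j) := by
      ext x
      simp [Matrix.mul_apply]
    rw [this]
    exact sum_mem fun l _ => mul_mem (hf i l).1 (hg l j).1
  · have : (fun x => (φ (f x * g x)⁻¹ : Matrix (Fin n) (Fin n) L) i j) =
        ∑ l, (fun x => (φ (g x)⁻¹ : Matrix (Fin n) (Fin n) L) i l) *
          (fun x => (φ (f x)⁻¹ : Matrix (Fin n) (Fin n) L) l j) := by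
      ext x
      simp only [mul_inv_rev, map_mul, Units.val_mul, Matrix.mul_apply, Finset.sum_apply,
        Pi.mul_apply]
    rw [this]
    exact sum_mem fun l _ => mul_mem (hg i l).2 (hf l j).2

theorem IsRegularMap.lift {α : Type*} {φ : G →* GL (Fin n) L} {c : α → G → G}
    (hc : ∀ i, IsRegularMap φ (c i)) (w : FreeGroup α) :
    IsRegularMap φ fun x => FreeGroup.lift (fun i => c i x) w := by
  induction w using FreeGroup.induction_on with
  | C1 => simpa using IsRegularMap.const φ 1
  | of x => simpa using hc x
  | inv_of x h => simpa using (hc x).inv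
  | mul x y hx hy => simpa using hx.mul hy

/-- A regular map that is constant on `S` is constant on every set on which all regular functions
vanishing on `S` vanish. -/
theorem IsRegularMap.eq_of_vanishingIdealOn_le {φ : G →* GL (Fin n) L}
    (hφ : Function.Injective φ) {f : G → G} (hf : IsRegularMap φ f) {S T : Set G}
    (hST : vanishingIdealOn φ S ≤ vanishingIdealOn φ T) {c : G} (hc : ∀ x ∈ S, f x = c) {x : G}
    (hx : x ∈ T) : f x = c := by
  apply hφ
  ext i j
  have hmem := sub_mem (hf i j).1 ((regularFunctions φ).algebraMap_mem
    ((φ c : Matrix (Fin n) (Fin n) L) i j))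
  have h := @hST ⟨_, hmem⟩ (fun y hy => by simp [hc y hy]) x hx
  simpa [sub_eq_zero] using h

end Regular

/-! ### The open marginal subgroup. -/

/-- In a profinite linear group, a word with fewer than continuum many values has an open marginal
subgroup. -/
theorem exists_isMarginal_openNormalSubgroup {k : ℕ} (w : FreeGroup (Fin k)) {G : Type u} [Group G]
    [TopologicalSpace G] [IsTopologicalGroup G] [CompactSpace G] [TotallyDisconnectedSpace G]
    [T2Space G] (hw : Cardinal.mk (wordValues w G) < Cardinal.continuum)
    {L : Type v} [Field L] {n : ℕ} (φ : G →* GL (Fin n) L) (hφ : Function.Injective φ) :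
    ∃ N : OpenNormalSubgroup G, IsMarginal w (N : Subgroup G) := by
  classical
  -- A maximal vanishing ideal: shrinking `N` further adds no equations, so smaller open normal
  -- subgroups are Zariski dense in `N`.
  obtain ⟨_, ⟨N, rfl⟩, hmax⟩ := (wellFounded_gt (α := Ideal (regularFunctions φ))).has_min
    (Set.range fun N : OpenNormalSubgroup G => vanishingIdealOn φ (N : Set G))
    ⟨_, ⟨⊤, inferInstanceAs (⊤ : Subgroup G).Normal⟩, rfl⟩
  have hN : ∀ N' : OpenNormalSubgroup G, N' ≤ N →
      vanishingIdealOn φ (N' : Set G) ≤ vanishingIdealOn φ (N : Set G) := by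
    intro N' hle
    have h1 : vanishingIdealOn φ (N : Set G) ≤ vanishingIdealOn φ (N' : Set G) :=
      fun f hf x hx => hf x (hle hx)
    exact (eq_of_le_of_not_lt h1 (hmax _ ⟨N', rfl⟩)).ge
  have key : ∀ (g : Fin k → G) (N' : OpenNormalSubgroup G), N' ≤ N →
      (∀ m : Fin k → G, (∀ i, m i ∈ N') → FreeGroup.lift (g * m) w = FreeGroup.lift g w) →
      ∀ m : Fin k → G, (∀ i, m i ∈ N) → FreeGroup.lift (g * m) w = FreeGroup.lift g w := by
    intro g N' hle h
    -- `S` holds the coordinates already freed from `N'` to `N`; freeing one more uses density in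
    -- that single variable.
    have : ∀ (S : Finset (Fin k)) (m : Fin k → G), (∀ i, m i ∈ N) → (∀ i ∉ S, m i ∈ N') →
        FreeGroup.lift (g * m) w = FreeGroup.lift g w := by
      intro S
      induction S using Finset.induction_on with
      | empty => exact fun m _ hm => h m fun i => hm i (Finset.notMem_empty i)
      | insert a S ha ih =>
        intro m hm hm'
        have hreg : IsRegularMap φ
            fun x => FreeGroup.lift (fun i => g i * Function.update m a x i) w := by
          refine IsRegularMap.lift (c := fun i x => g i * Function.update m a x i) (fun i => ?_) w
          refine (IsRegularMap.const φ (g i)).mul ?_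
          by_cases hi : i = a
          · subst hi
            simpa using IsRegularMap.id φ
          · simpa [hi] using IsRegularMap.const φ (m i)
        have := hreg.eq_of_vanishingIdealOn_le hφ (hN N' hle) (c := FreeGroup.lift g w)
          (fun x hx => ih (Function.update m a x) (fun i => ?_) (fun i hi => ?_)) (hm a)
        · simpa [Pi.mul_def] using this
        · by_cases hi : i = a
          · subst hi
            simpa using hle hx
          · simpa [hi] using hm i
        · by_cases hia : i = a
          · subst hia
            simpa using hx
          · simpa [hia] using hm' i (by simp [hia, hi])
    exact fun m hm => this Finset.univ m hm (by simp)
  refine ⟨N, fun g m hm => ?_⟩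
  obtain ⟨m₀, hm₀, N', hle, hc⟩ := exists_constant_box w hw N g
  -- Both `g` and `g * m` lie in the box of `N`-cosets around `g * m₀`, so `w` agrees at them.
  have h := key (g * m₀) N' hle hc
  have h1 := h (m₀⁻¹ * m) fun i => N.mul_mem' (N.inv_mem' (hm₀ i)) (hm i)
  have h2 := h m₀⁻¹ fun i => N.inv_mem' (hm₀ i)
  rw [mul_assoc, mul_inv_cancel_left] at h1
  rw [mul_assoc, mul_inv_cancel, mul_one] at h2
  rw [h1, h2]

/-! ### Marginal subgroups of abstract groups. -/

section Marginal

variable {k : ℕ} {w : FreeGroup (Fin k)}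

theorem map_lift_apply {G H : Type*} [Group G] [Group H] (f : G →* H) (g : Fin k → G) :
    FreeGroup.lift (fun i => f (g i)) w = f (FreeGroup.lift g w) := by
  have : FreeGroup.lift (fun i => f (g i)) = f.comp (FreeGroup.lift g) := by
    ext i
    simp
  rw [this, MonoidHom.comp_apply]

theorem lift_mem {G : Type*} [Group G] (R : Subgroup G) {g : Fin k → G} (hg : ∀ i, g i ∈ R) :
    FreeGroup.lift g w ∈ R := by
  have := map_lift_apply (w := w) R.subtype fun i => ⟨g i, hg i⟩
  rw [show g = fun i => R.subtype ⟨g i, hg i⟩ from rfl, this]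
  exact SetLike.coe_mem _

theorem map_mem_verbalSubgroup {G H : Type*} [Group G] [Group H] (f : G →* H) {z : G}
    (hz : z ∈ verbalSubgroup w G) : f z ∈ verbalSubgroup w H := by
  have : verbalSubgroup w G ≤ (verbalSubgroup w H).comap f := by
    refine (Subgroup.closure_le _).2 ?_
    rintro _ ⟨g, rfl⟩
    exact Subgroup.subset_closure ⟨fun i => f (g i), map_lift_apply f g⟩
  exact this hz

theorem IsMarginal.map {G H : Type*} [Group G] [Group H] {N : Subgroup G} (hN : IsMarginal w N)
    (f : G →* H) (hf : Function.Surjective f) : IsMarginal w (N.map f) := by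
  intro g n hn
  choose n' hn' hnn using hn
  choose g' hg' using fun i => hf (g i)
  have h := congrArg f (hN g' n' hn')
  rw [← map_lift_apply, ← map_lift_apply] at h
  simp only [Pi.mul_apply, map_mul, hnn, hg'] at h
  exact h

theorem IsMarginal.subgroupOf {G : Type*} [Group G] {N : Subgroup G} (hN : IsMarginal w N)
    (H : Subgroup G) : IsMarginal w (N.subgroupOf H) := by
  intro g n hn
  apply H.subtype_injective
  rw [← map_lift_apply, ← map_lift_apply]
  exact hN (fun i => H.subtype (g i)) (fun i => H.subtype (n i)) hn

/-- Any supplement of `N` already realises all values. This serves both for small supplements in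
finite groups and for the passage to a finitely generated subgroup. -/
theorem IsMarginal.exists_lift_eq {G : Type*} [Group G] {N R : Subgroup G} [N.Normal]
    (hN : IsMarginal w N) (hR : R ⊔ N = ⊤) (g : Fin k → G) :
    ∃ r : Fin k → G, (∀ i, r i ∈ R) ∧ FreeGroup.lift g w = FreeGroup.lift r w := by
  have h : ∀ i, ∃ r ∈ R, ∃ n ∈ N, r * n = g i := fun i =>
    Subgroup.mem_sup_of_normal_right.1 (hR ▸ Subgroup.mem_top (g i))
  choose r hr n hn hrn using h
  exact ⟨r, hr, by rw [← hN r n hn, show r * n = g from funext hrn]⟩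

theorem IsMarginal.verbalSubgroup_le {G : Type*} [Group G] {N R : Subgroup G} [N.Normal]
    (hN : IsMarginal w N) (hR : R ⊔ N = ⊤) : verbalSubgroup w G ≤ R := by
  refine (Subgroup.closure_le _).2 ?_
  rintro _ ⟨g, rfl⟩
  obtain ⟨r, hr, h⟩ := hN.exists_lift_eq hR g
  simp only [h]
  exact lift_mem R hr

theorem IsMarginal.finite_wordValues {G : Type*} [Group G] {N : Subgroup G} [N.FiniteIndex]
    (hN : IsMarginal w N) : (wordValues w G).Finite := by
  have : wordValues w G ⊆ Set.range fun q : Fin k → G ⧸ N =>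
      FreeGroup.lift (fun i => (q i).out) w := by
    rintro _ ⟨g, rfl⟩
    refine ⟨fun i => g i, ?_⟩
    have h := hN g (fun i => (g i)⁻¹ * (g i : G ⧸ N).out) fun i =>
      QuotientGroup.eq.1 (QuotientGroup.out_eq' (g i : G ⧸ N)).symm
    refine Eq.trans ?_ h
    dsimp only
    congr 2
    ext i
    simp
  exact (Set.finite_range _).subset this

/-- Elements of a marginal subgroup commute with the verbal subgroup. -/
theorem IsMarginal.commute {G : Type*} [Group G] {N : Subgroup G} [N.Normal]
    (hN : IsMarginal w N) {x z : G} (hx : x ∈ N) (hz : z ∈ verbalSubgroup w G) :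
    x * z = z * x := by
  have : verbalSubgroup w G ≤ Subgroup.centralizer {x} := by
    refine (Subgroup.closure_le _).2 ?_
    rintro _ ⟨g, rfl⟩
    -- Conjugation by `x ∈ N` moves each argument only within its coset of `N`, so it fixes the
    -- value.
    have h1 := map_lift_apply (w := w) (MulAut.conj x).toMonoidHom g
    have h2 := hN g (fun i => (g i)⁻¹ * (x * g i * x⁻¹)) fun i => by
      have := N.mul_mem (‹N.Normal›.conj_mem x hx (g i)⁻¹) (N.inv_mem hx)
      simpa [mul_assoc] using this
    have h3 : (g * fun i => (g i)⁻¹ * (x * g i * x⁻¹)) =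
        fun i => (MulAut.conj x).toMonoidHom (g i) := by
      ext i
      simp [mul_assoc]
    rw [h3, h1] at h2
    simp only [MulEquiv.coe_toMonoidHom, MulAut.conj_apply] at h2
    refine Subgroup.mem_centralizer_iff.2 ?_
    rintro _ rfl
    exact mul_inv_eq_iff_eq_mul.1 h2
  exact Subgroup.mem_centralizer_iff.1 (this hz) x rfl

/-- A verbal subgroup with a marginal subgroup of finite index is finite once it is torsion. -/
theorem IsMarginal.finite_verbalSubgroup {G : Type*} [Group G] {N : Subgroup G} [N.Normal]
    [N.FiniteIndex] (hN : IsMarginal w N) (ht : ∀ z ∈ verbalSubgroup w G, IsOfFinOrder z) :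
    Finite (verbalSubgroup w G) := by
  have hfg : Group.FG (verbalSubgroup w G) := by
    rw [Group.fg_iff_subgroup_fg, Subgroup.fg_iff]
    exact ⟨_, rfl, hN.finite_wordValues⟩
  let Z : Subgroup (verbalSubgroup w G) := N.subgroupOf (verbalSubgroup w G)
  have hZfg : Group.FG Z := Subgroup.fg_of_index_ne_zero Z
  let : CommGroup Z :=
    { (inferInstance : Group Z) with
      mul_comm := fun a b => Subtype.ext (Subtype.ext (hN.commute a.2 b.1.2)) }
  have hZ : Finite Z := by
    refine CommGroup.finite_of_fg_isMulTorsion Z ?_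
    intro z
    have hinj : Function.Injective ((verbalSubgroup w G).subtype.comp Z.subtype) :=
      (verbalSubgroup w G).subtype_injective.comp Z.subtype_injective
    exact hinj.isOfFinOrder_iff.1 (ht _ z.1.2)
  have : Finite (verbalSubgroup w G ⧸ Z) := Subgroup.finite_quotient_of_finiteIndex
  exact Finite.of_subgroup_quotient Z

end Marginal

/-! ### Orders in finite images. -/

section FiniteGroup

/-- For a Sylow `p`-subgroup `P` of `M`, Frattini gives `Q = N_Q(P) M`. As `p` does not divide `|Q :
P|`, Schur–Zassenhaus complements `P` in its normalizer by a group of order prime to `p`; since `P ≤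
M`, this complement still supplements `M`. -/
theorem Subgroup.exists_supplement_of_not_dvd_index {Q : Type*} [Group Q] [Finite Q]
    (M : Subgroup Q) [M.Normal] {p : ℕ} [hp : Fact p.Prime] (hpM : ¬ p ∣ M.index) :
    ∃ R : Subgroup Q, R ⊔ M = ⊤ ∧ ¬ p ∣ Nat.card R := by
  obtain ⟨P⟩ : Nonempty (Sylow p M) := inferInstance
  set P' : Subgroup Q := (P : Subgroup M).map M.subtype with hP'
  set H : Subgroup Q := Subgroup.normalizer (P' : Set Q) with hH
  have hHM : H ⊔ M = ⊤ := P.normalizer_sup_eq_top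
  have hPH : P' ≤ H := Subgroup.le_normalizer
  have hPM : P' ≤ M := Subgroup.map_subtype_le _
  have hPp : IsPGroup p P' := P.2.map _
  have hidx : ¬ p ∣ P'.index := by
    rw [← Subgroup.relIndex_mul_index hPM, hp.out.dvd_mul, not_or]
    refine ⟨?_, hpM⟩
    have : P'.relIndex M = (P : Subgroup M).index := by
      rw [Subgroup.relIndex, hP', Subgroup.subgroupOf, Subgroup.comap_map_eq_self_of_injective
        M.subtype_injective]
    rw [this]
    exact P.not_dvd_index
  have hidx' : ¬ p ∣ (P'.subgroupOf H).index := fun h =>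
    hidx (h.trans (by rw [← Subgroup.relIndex_mul_index hPH]; exact dvd_mul_right _ _))
  have : (P'.subgroupOf H).Normal := inferInstance
  have hcop : Nat.Coprime (Nat.card (P'.subgroupOf H)) (P'.subgroupOf H).index := by
    obtain ⟨a, ha⟩ := (IsPGroup.iff_card (p := p)).1
      (hPp.of_equiv (Subgroup.subgroupOfEquivOfLe hPH).symm)
    rw [ha]
    exact Nat.Coprime.pow_left _ ((Nat.Prime.coprime_iff_not_dvd hp.out).2 hidx')
  obtain ⟨K, hK⟩ := Subgroup.exists_right_complement'_of_coprime hcop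
  refine ⟨K.map H.subtype, ?_, ?_⟩
  · rw [eq_top_iff, ← hHM]
    refine sup_le ?_ le_sup_right
    have h1 : H = ((P'.subgroupOf H) ⊔ K).map H.subtype := by
      rw [hK.sup_eq_top, ← MonoidHom.range_eq_map, Subgroup.range_subtype]
    rw [Subgroup.map_sup, Subgroup.map_subgroupOf_eq_of_le hPH] at h1
    refine h1.le.trans ?_
    exact sup_le (hPM.trans le_sup_right) le_sup_left
  · rw [Subgroup.card_map_of_injective H.subtype_injective, ← hK.symm.index_eq_card]
    exact hidx'

/-- In finite images, elements of the verbal subgroup have order prime to every prime not dividing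
the index of a marginal subgroup. -/
theorem IsMarginal.not_dvd_orderOf {k : ℕ} {w : FreeGroup (Fin k)} {G : Type*} [Group G]
    {N : Subgroup G} [N.Normal] (hN : IsMarginal w N) {H : Type*} [Group H] [Finite H]
    (f : G →* H) {p : ℕ} (hp : p.Prime) (hpN : ¬ p ∣ N.index) {z : G}
    (hz : z ∈ verbalSubgroup w G) : ¬ p ∣ orderOf (f z) := by
  have := Fact.mk hp
  have hsurj := f.rangeRestrict_surjective
  have := (inferInstance : N.Normal).map f.rangeRestrict hsurj
  obtain ⟨R, hR, hpR⟩ := (N.map f.rangeRestrict).exists_supplement_of_not_dvd_index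
    fun h => hpN (h.trans (Subgroup.index_map_dvd N hsurj))
  have h1 := (hN.map _ hsurj).verbalSubgroup_le hR (map_mem_verbalSubgroup f.rangeRestrict hz)
  have h2 : orderOf (f z) = orderOf (f.rangeRestrict z) :=
    orderOf_injective f.range.subtype f.range.subtype_injective (f.rangeRestrict z)
  rw [h2]
  exact fun h => hpR (h.trans (Subgroup.orderOf_dvd_natCard R h1))

end FiniteGroup

/-! ### Elements inverted in a finitely generated extension. -/

section GenericIntegrality

/-- If an `R`-algebra `A` of finite type maps to a finite extension of the fraction field of `R`,
then the elements of `R` that become units in `A` all divide powers of a single nonzero element. -/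
theorem AlgHom.exists_dvd_pow_of_isUnit {R K E A : Type*} [CommRing R] [IsDomain R]
    [IsIntegrallyClosed R] [Field K] [Algebra R K] [IsFractionRing R K] [Field E] [Algebra R E]
    [Algebra K E] [IsScalarTower R K E] [Module.Finite K E] [CommRing A] [Algebra R A]
    [hA : Algebra.FiniteType R A] (ψ : A →ₐ[R] E) :
    ∃ f : R, f ≠ 0 ∧ ∀ r : R, IsUnit (algebraMap R A r) → ∃ N : ℕ, r ∣ f ^ N := by
  classical
  obtain ⟨S, hS⟩ := hA.out
  have halg : ∀ x : E, ∃ y : R, y ≠ 0 ∧ IsIntegral R (y • x) := fun x =>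
    ((IsFractionRing.isAlgebraic_iff R K E).2
      (Algebra.IsAlgebraic.isAlgebraic (R := K) x)).exists_integral_multiple
  choose y hy0 hy using halg
  -- A common denominator: it makes the images of all generators integral, and its powers do so for
  -- all of `ψ(A)`.
  let f : R := ∏ s ∈ S, y (ψ s)
  have hint : ∀ a : A, ∃ N : ℕ, IsIntegral R (f ^ N • ψ a) := by
    intro a
    have ha : a ∈ Algebra.adjoin R (S : Set A) := hS ▸ Algebra.mem_top
    induction ha using Algebra.adjoin_induction with
    | mem s hs =>
      refine ⟨1, ?_⟩
      obtain ⟨c, hc⟩ := Finset.dvd_prod_of_mem (fun s : A => y (ψ s)) hs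
      rw [pow_one, show f = _ from hc, mul_comm, mul_smul]
      exact (hy _).smul c
    | algebraMap r =>
      refine ⟨0, ?_⟩
      rw [pow_zero, one_smul, AlgHom.commutes]
      exact isIntegral_algebraMap
    | add a b ha hb iha ihb =>
      obtain ⟨N, hN⟩ := iha
      obtain ⟨M, hM⟩ := ihb
      refine ⟨M + N, ?_⟩
      have := (hN.smul (f ^ M)).add (hM.smul (f ^ N))
      rw [← mul_smul, ← mul_smul, ← pow_add, ← pow_add, add_comm N M, ← smul_add, ← map_add] at this
      exact this
    | mul a b ha hb iha ihb =>
      obtain ⟨N, hN⟩ := iha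
      obtain ⟨M, hM⟩ := ihb
      refine ⟨N + M, ?_⟩
      have := hN.mul hM
      rw [smul_mul_smul_comm, ← pow_add, ← map_mul] at this
      exact this
  refine ⟨f, Finset.prod_ne_zero_iff.2 fun s _ => hy0 _, fun r hr => ?_⟩
  obtain ⟨b, hb⟩ := hr.exists_right_inv
  obtain ⟨N, hN⟩ := hint b
  have hr1 : algebraMap R E r * ψ b = 1 := by
    rw [← map_one ψ, ← hb, map_mul, AlgHom.commutes]
  have hr0 : algebraMap R K r ≠ 0 := by
    intro h
    rw [IsScalarTower.algebraMap_apply R K E, h, map_zero, zero_mul] at hr1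
    exact zero_ne_one hr1
  -- As `ψ b` is the inverse of `r`, the fraction `f ^ N / r` is integral, hence in `R`.
  have hψ : f ^ N • ψ b = algebraMap K E (algebraMap R K (f ^ N) / algebraMap R K r) := by
    rw [map_div₀, ← IsScalarTower.algebraMap_apply, ← IsScalarTower.algebraMap_apply,
      eq_div_iff, Algebra.smul_def, mul_assoc, mul_comm (ψ b), hr1, mul_one]
    exact fun h => by simp [h] at hr1
  rw [hψ, isIntegral_algebraMap_iff (algebraMap K E).injective] at hN
  obtain ⟨c, hc⟩ := IsIntegrallyClosed.isIntegral_iff.1 hN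
  refine ⟨N, c, IsFractionRing.injective R K ?_⟩
  rw [map_mul, hc, mul_div_cancel₀ _ hr0]

/-- In a finitely generated extension `A` of an integrally closed domain `R` inside a field, the
elements of `R` that become units in `A` all divide powers of a single nonzero element. -/
theorem Subalgebra.FG.exists_dvd_pow_of_isUnit {R L : Type*} [CommRing R] [IsDomain R]
    [IsIntegrallyClosed R] [Field L] [Algebra R L] [FaithfulSMul R L] {A : Subalgebra R L}
    (hA : A.FG) :
    ∃ f : R, f ≠ 0 ∧ ∀ r : R, IsUnit (algebraMap R A r) → ∃ N : ℕ, r ∣ f ^ N := by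
  have hAf := (Subalgebra.fg_iff_finiteType A).1 hA
  obtain ⟨S, rfl⟩ := hA
  let K := FractionRing R
  let : Algebra K L := FractionRing.liftAlgebra R L
  have : IsScalarTower R K L := FractionRing.isScalarTower_liftAlgebra R L
  let B := Algebra.adjoin K (S : Set L)
  have hBfg : Algebra.FiniteType K B := (Subalgebra.fg_iff_finiteType B).1 ⟨S, rfl⟩
  obtain ⟨𝔫, h𝔫⟩ := Ideal.exists_maximal B
  let : Field (B ⧸ 𝔫) := Ideal.Quotient.field 𝔫
  -- Zariski's lemma.
  have : Module.Finite K (B ⧸ 𝔫) := finite_of_finite_type_of_isJacobsonRing K (B ⧸ 𝔫)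
  have hAB : Algebra.adjoin R (S : Set L) ≤ B.restrictScalars R :=
    Algebra.adjoin_le Algebra.subset_adjoin
  exact AlgHom.exists_dvd_pow_of_isUnit (K := K)
    ((Ideal.Quotient.mkₐ R 𝔫).comp (Subalgebra.inclusion hAB))

end GenericIntegrality

/-! ### Finitely generated rings and congruences of matrices. -/

/-- Residue fields of positive characteristic of finitely generated rings are finite. -/
theorem Ideal.finite_quotient_of_finiteType_int {A : Type*} [CommRing A] [Algebra.FiniteType ℤ A]
    {p : ℕ} (hp : p.Prime) (𝔪 : Ideal A) [h𝔪 : 𝔪.IsMaximal] (hmem : (p : A) ∈ 𝔪) :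
    Finite (A ⧸ 𝔪) := by
  have := Fact.mk hp
  let : Field (A ⧸ 𝔪) := Ideal.Quotient.field 𝔪
  have h0 : (p : A ⧸ 𝔪) = 0 := by
    simpa using Ideal.Quotient.eq_zero_iff_mem.2 hmem
  have : CharP (A ⧸ 𝔪) p := (CharP.charP_iff_prime_eq_zero hp).2 h0
  let : Algebra (ZMod p) (A ⧸ 𝔪) := ZMod.algebra _ p
  have : Algebra.FiniteType ℤ (A ⧸ 𝔪) := inferInstance
  have : Algebra.FiniteType (ZMod p) (A ⧸ 𝔪) :=
    Algebra.FiniteType.of_restrictScalars_finiteType ℤ (ZMod p) (A ⧸ 𝔪)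
  have : Module.Finite (ZMod p) (A ⧸ 𝔪) := finite_of_finite_type_of_isJacobsonRing _ _
  exact Module.finite_of_finite (ZMod p)

/-- A finitely generated linear group is defined over every ring containing finitely many
prescribed elements of the field. -/
theorem exists_finset_forall_exists_lift_generalLinearGroup {Γ : Type*} [Group Γ] [Group.FG Γ]
    {L : Type v} [Field L] {n : ℕ} (φ : Γ →* GL (Fin n) L) :
    ∃ S : Finset L, ∀ (A : Type v) [CommRing A] (ι : A →+* L), Function.Injective ι →
      (S : Set L) ⊆ Set.range ι →
      ∃ ψ : Γ →* GL (Fin n) A, ∀ γ, Matrix.GeneralLinearGroup.map ι (ψ γ) = φ γ := by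
  classical
  obtain ⟨T, hT⟩ := Group.fg_def.1 ‹Group.FG Γ›
  let S : Finset L := T.biUnion fun g => Finset.univ.image
    (fun ij : Fin n × Fin n => (φ g : Matrix (Fin n) (Fin n) L) ij.1 ij.2) ∪
      Finset.univ.image (fun ij : Fin n × Fin n =>
        ((φ g)⁻¹ : GL (Fin n) L).1 ij.1 ij.2)
  refine ⟨S, fun A _ ι hι hS => ?_⟩
  have hinj : Function.Injective (Matrix.GeneralLinearGroup.map (n := Fin n) ι) := by
    intro x y hxy
    ext i j
    apply hι
    simpa using congrArg (fun M : GL (Fin n) L => M.1 i j) hxy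
  have hrange : φ.range ≤ (Matrix.GeneralLinearGroup.map (n := Fin n) ι).range := by
    rw [MonoidHom.range_eq_map, ← hT, Subgroup.map_le_iff_le_comap, Subgroup.closure_le]
    intro g hg
    have h1 : ∀ i j, ∃ a, ι a = (φ g : Matrix (Fin n) (Fin n) L) i j := fun i j =>
      hS (Finset.mem_biUnion.2 ⟨g, hg, Finset.mem_union_left _
        (Finset.mem_image.2 ⟨(i, j), Finset.mem_univ _, rfl⟩)⟩)
    have h2 : ∀ i j, ∃ a, ι a = ((φ g)⁻¹ : GL (Fin n) L).1 i j := fun i j =>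
      hS (Finset.mem_biUnion.2 ⟨g, hg, Finset.mem_union_right _
        (Finset.mem_image.2 ⟨(i, j), Finset.mem_univ _, rfl⟩)⟩)
    choose a ha using h1
    choose b hb using h2
    have ha' : ι.mapMatrix (Matrix.of a) = (φ g).1 := Matrix.ext fun i j => ha i j
    have hb' : ι.mapMatrix (Matrix.of b) = ((φ g)⁻¹ : GL (Fin n) L).1 :=
      Matrix.ext fun i j => hb i j
    have hmi : Function.Injective (ι.mapMatrix : Matrix (Fin n) (Fin n) A →+* _) :=
      fun x y h => Matrix.ext fun i j => hι (congrFun (congrFun h i) j)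
    refine ⟨⟨Matrix.of a, Matrix.of b, hmi ?_, hmi ?_⟩, ?_⟩
    · rw [map_mul, ha', hb', map_one, Units.mul_inv]
    · rw [map_mul, ha', hb', map_one, Units.inv_mul]
    · exact Units.ext ha'
  let e := MonoidHom.ofInjective hinj
  refine ⟨e.symm.toMonoidHom.comp (φ.codRestrict _ fun γ => hrange ⟨γ, rfl⟩), fun γ => ?_⟩
  exact congrArg Subtype.val (e.apply_symm_apply ⟨φ γ, hrange ⟨γ, rfl⟩⟩)

theorem Matrix.mem_ideal_iff_map_eq_zero {n : ℕ} {A : Type*} [CommRing A] (I : Ideal A)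
    (X : Matrix (Fin n) (Fin n) A) :
    (∀ a b, X a b ∈ I) ↔ (Ideal.Quotient.mk I).mapMatrix X = 0 := by
  simp only [← Ideal.Quotient.eq_zero_iff_mem, ← Matrix.ext_iff, RingHom.mapMatrix_apply,
    Matrix.map_apply, Matrix.zero_apply]

/-- If `X ≡ 1` modulo an ideal `I` containing `p`, then `X ^ p ^ j ≡ 1` modulo `I ^ (j + 1)`. -/
theorem Matrix.pow_pow_sub_one_mem {n : ℕ} {A : Type*} [CommRing A] {I : Ideal A} {p : ℕ}
    (hp : (p : A) ∈ I) {X : Matrix (Fin n) (Fin n) A} (hX : ∀ a b, (X - 1) a b ∈ I) (j : ℕ) :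
    ∀ a b, (X ^ p ^ j - 1) a b ∈ I ^ (j + 1) := by
  induction j with
  | zero => simpa using hX
  | succ j ih =>
    have h1 : ∀ a b, (X ^ p ^ j - 1) a b ∈ I := fun a b =>
      Ideal.pow_le_self (Nat.succ_ne_zero j) (ih a b)
    rw [Matrix.mem_ideal_iff_map_eq_zero, map_sub, map_one, sub_eq_zero] at h1
    -- Modulo `I` the geometric sum has `p` terms equal to 1, so it vanishes and gains one more
    -- factor of `I`.
    have h2 : ∀ a b, (∑ i ∈ Finset.range p, (X ^ p ^ j) ^ i) a b ∈ I := by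
      rw [Matrix.mem_ideal_iff_map_eq_zero, map_sum]
      simp only [map_pow] at h1 ⊢
      simp only [h1, one_pow, Finset.sum_const, Finset.card_range]
      have h0 : (p : A ⧸ I) = 0 := by simpa using Ideal.Quotient.eq_zero_iff_mem.2 hp
      rw [← Nat.cast_smul_eq_nsmul (A ⧸ I), h0, zero_smul]
    intro a b
    rw [pow_succ p, pow_mul, ← mul_geom_sum, Matrix.mul_apply, pow_succ I]
    exact sum_mem fun c _ => Ideal.mul_mem_mul (ih a c) (h2 c b)

/-! ### Torsion in characteristic zero. -/

section Torsion

variable {k : ℕ} {w : FreeGroup (Fin k)} {Γ : Type*} [Group Γ] {N : Subgroup Γ} [N.Normal]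

theorem Matrix.GeneralLinearGroup.map_eq_one_iff_sub_one_mem {n : ℕ} {A : Type*} [CommRing A]
    (I : Ideal A) (X : GL (Fin n) A) :
    Matrix.GeneralLinearGroup.map (Ideal.Quotient.mk I) X = 1 ↔
      ∀ a b, (X.1 - 1) a b ∈ I := by
  rw [Matrix.mem_ideal_iff_map_eq_zero, map_sub, map_one, sub_eq_zero, Units.ext_iff]
  rfl

/-- Torsion of the verbal subgroup via congruence quotients at a prime that is not invertible. -/
theorem IsMarginal.exists_pow_eq_one_of_not_isUnit (hN : IsMarginal w N) {n : ℕ} {A : Type*}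
    [CommRing A] [IsDomain A] [Algebra.FiniteType ℤ A] (ψ : Γ →* GL (Fin n) A) {p : ℕ}
    (hp : p.Prime) (hpN : ¬ p ∣ N.index) (hpA : ¬ IsUnit (p : A)) {z : Γ}
    (hz : z ∈ verbalSubgroup w Γ) : ∃ d, 0 < d ∧ ψ (z ^ d) = 1 := by
  have hnoeth : IsNoetherianRing A := Algebra.FiniteType.isNoetherianRing ℤ A
  obtain ⟨𝔪, h𝔪, hp𝔪⟩ := exists_max_ideal_of_mem_nonunits hpA
  have hfin := Ideal.finite_quotient_of_finiteType_int hp 𝔪 hp𝔪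
  have hfin' : ∀ j, Finite (A ⧸ 𝔪 ^ j) :=
    Ideal.finite_quotient_pow (IsNoetherian.noetherian 𝔪)
  -- Modulo each power of `𝔪` such a `y` has order both a power of `p` and prime to `p`, so it is
  -- trivial there; Krull's intersection theorem concludes.
  have hker : ∀ y ∈ verbalSubgroup w Γ, (∀ a b, ((ψ y).1 - 1) a b ∈ 𝔪) → ψ y = 1 := by
    intro y hy hy𝔪
    have hmem : ∀ j a b, ((ψ y).1 - 1) a b ∈ 𝔪 ^ (j + 1) := by
      intro j
      have := hfin' (j + 1)
      have : Finite (GL (Fin n) (A ⧸ 𝔪 ^ (j + 1))) := inferInstance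
      let F := (Matrix.GeneralLinearGroup.map (n := Fin n)
        (Ideal.Quotient.mk (𝔪 ^ (j + 1)))).comp ψ
      have h1 : F y ^ p ^ j = 1 := by
        have := (Matrix.GeneralLinearGroup.map_eq_one_iff_sub_one_mem (𝔪 ^ (j + 1))
          (ψ y ^ p ^ j)).2 (by simpa using Matrix.pow_pow_sub_one_mem hp𝔪 hy𝔪 j)
        simpa [F] using this
      obtain ⟨m, -, hm⟩ := (Nat.dvd_prime_pow hp).1 (orderOf_dvd_of_pow_eq_one h1)
      have h2 := hN.not_dvd_orderOf F hp hpN hy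
      rcases Nat.eq_zero_or_pos m with rfl | hm0
      · rw [pow_zero, orderOf_eq_one_iff] at hm
        exact (Matrix.GeneralLinearGroup.map_eq_one_iff_sub_one_mem _ _).1 hm
      · exact absurd (hm ▸ dvd_pow_self p hm0.ne') h2
    refine Units.ext (sub_eq_zero.1 (Matrix.ext fun a b => ?_))
    have : ((ψ y).1 - 1) a b ∈ ⨅ i, 𝔪 ^ i := by
      refine Ideal.mem_iInf.2 fun i => ?_
      exact Ideal.pow_le_pow_right (Nat.le_succ i) (hmem i a b)
    rw [Ideal.iInf_pow_eq_bot_of_isDomain 𝔪 h𝔪.ne_top] at this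
    exact this
  let F := (Matrix.GeneralLinearGroup.map (n := Fin n) (Ideal.Quotient.mk 𝔪)).comp ψ
  have : Finite (GL (Fin n) (A ⧸ 𝔪)) := inferInstance
  refine ⟨orderOf (F z), orderOf_pos _, hker _ (Subgroup.pow_mem _ hz _) ?_⟩
  rw [← Matrix.GeneralLinearGroup.map_eq_one_iff_sub_one_mem]
  have : F (z ^ orderOf (F z)) = 1 := by rw [map_pow, pow_orderOf_eq_one]
  exact this

theorem Nat.exists_prime_not_dvd_not_dvd {a b : ℕ} (ha : a ≠ 0) (hb : b ≠ 0) :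
    ∃ p, p.Prime ∧ ¬ p ∣ a ∧ ¬ p ∣ b := by
  obtain ⟨p, hle, hp⟩ := Nat.exists_infinite_primes (a + b + 1)
  exact ⟨p, hp, fun h => by have := Nat.le_of_dvd (Nat.pos_of_ne_zero ha) h; omega,
    fun h => by have := Nat.le_of_dvd (Nat.pos_of_ne_zero hb) h; omega⟩

/-- Only primes dividing one fixed nonzero integer can be invertible in the ring of entries, so some
prime that does not divide the index stays a non-unit. -/
theorem IsMarginal.isOfFinOrder_of_charZero [Group.FG Γ] [hfi : N.FiniteIndex]
    (hN : IsMarginal w N) {n : ℕ} {L : Type v} [Field L] [CharZero L] (φ : Γ →* GL (Fin n) L)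
    (hφ : Function.Injective φ) {z : Γ} (hz : z ∈ verbalSubgroup w Γ) : IsOfFinOrder z := by
  obtain ⟨S, hS⟩ := exists_finset_forall_exists_lift_generalLinearGroup φ
  let A := Algebra.adjoin ℤ (S : Set L)
  have hA : A.FG := ⟨S, rfl⟩
  have hAf : Algebra.FiniteType ℤ A := (Subalgebra.fg_iff_finiteType A).1 hA
  obtain ⟨ψ, hψ⟩ := hS A A.val.toRingHom Subtype.val_injective
    fun s hs => ⟨⟨s, Algebra.subset_adjoin hs⟩, rfl⟩
  obtain ⟨f, hf0, hf⟩ := hA.exists_dvd_pow_of_isUnit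
  obtain ⟨p, hp, hpf, hpN⟩ := Nat.exists_prime_not_dvd_not_dvd (Int.natAbs_ne_zero.2 hf0)
    hfi.index_ne_zero
  have hpA : ¬ IsUnit (p : A) := fun h => by
    obtain ⟨M, hM⟩ := hf p (by simpa using h)
    exact hpf (Int.natCast_dvd.1 (Int.Prime.dvd_pow' hp hM))
  obtain ⟨d, hd, h⟩ := hN.exists_pow_eq_one_of_not_isUnit ψ hp hpN hpA hz
  refine isOfFinOrder_iff_pow_eq_one.2 ⟨d, hd, hφ ?_⟩
  rw [← hψ, h, map_one, map_one]

end Torsion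

/-! ### Torsion in positive characteristic. -/

open Polynomial in
/-- There are irreducible polynomials over `ZMod p` not dividing `f` whose roots have prime order
`q` not dividing `m`. -/
theorem ZMod.exists_irreducible_dvd_X_pow_sub_one {p : ℕ} [hp : Fact p.Prime] {f : (ZMod p)[X]}
    (hf : f ≠ 0) {m : ℕ} (hm : m ≠ 0) :
    ∃ (q : ℕ) (g : (ZMod p)[X]), q.Prime ∧ ¬ q ∣ m ∧ Irreducible g ∧ ¬ g ∣ f ∧
      g ∣ X ^ q - 1 ∧ g.eval 1 ≠ 0 := by
  classical
  let Ω := AlgebraicClosure (ZMod p)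
  -- A bound for the orders of the roots of `f`: a primitive `q`-th root of unity with `q > B` is
  -- not among them.
  let B := ∑ β ∈ (f.aroots Ω).toFinset, orderOf β
  obtain ⟨q, hle, hq⟩ := Nat.exists_infinite_primes (B + m + p + 1)
  have : NeZero (q : Ω) := ⟨fun h => by
    rw [CharP.cast_eq_zero_iff Ω p, Nat.prime_dvd_prime_iff_eq hp.out hq] at h
    omega⟩
  have : NeZero q := ⟨hq.ne_zero⟩
  obtain ⟨α, hα⟩ := HasEnoughRootsOfUnity.exists_primitiveRoot Ω q
  have hint : IsIntegral (ZMod p) α := Algebra.IsIntegral.isIntegral α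
  refine ⟨q, minpoly (ZMod p) α, hq, fun h => ?_, minpoly.irreducible hint, fun h => ?_,
    minpoly.dvd _ _ (by simp [hα.pow_eq_one]), fun h => ?_⟩
  · have := Nat.le_of_dvd (Nat.pos_of_ne_zero hm) h
    omega
  · have hmem : α ∈ (f.aroots Ω).toFinset := by
      rw [Multiset.mem_toFinset, mem_aroots]
      exact ⟨hf, (minpoly.dvd_iff).1 h⟩
    have h1 : orderOf α ≤ B :=
      Finset.single_le_sum (f := fun β : Ω => orderOf β) (fun _ _ => Nat.zero_le _) hmem
    rw [← hα.eq_orderOf] at h1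
    omega
  · have h1 : algebraMap (ZMod p) Ω 1 = α := minpoly.root hint h
    rw [map_one] at h1
    exact hα.ne_one hq.one_lt h1.symm

theorem Matrix.pow_eq_one_of_isRoot_charpoly {n : ℕ} {K : Type*} [Field K]
    {X : Matrix (Fin n) (Fin n) K} {μ : K} (hμ : X.charpoly.IsRoot μ) {d : ℕ} (hX : X ^ d = 1) :
    μ ^ d = 1 := by
  have h := spectrum.pow_mem_pow X d (Matrix.mem_spectrum_iff_isRoot_charpoly.2 hμ)
  rcases subsingleton_or_nontrivial (Matrix (Fin n) (Fin n) K) with hs | hs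
  · rw [spectrum.of_subsingleton] at h
    exact h.elim
  · rw [hX, spectrum.one_eq] at h
    exact h

section Torsion

variable {k : ℕ} {w : FreeGroup (Fin k)} {Γ : Type*} [Group Γ] {N : Subgroup Γ} [N.Normal]

open Polynomial in
/-- In positive characteristic, the eigenvalues of elements of the verbal subgroup are algebraic
over the prime field. -/
theorem IsMarginal.isAlgebraic_of_isRoot_charpoly [Group.FG Γ] [hfi : N.FiniteIndex]
    (hN : IsMarginal w N) {n : ℕ} {L : Type v} [Field L] {p : ℕ} [hp : Fact p.Prime]
    [Algebra (ZMod p) L] (φ : Γ →* GL (Fin n) L) {z : Γ} (hz : z ∈ verbalSubgroup w Γ) {x : L}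
    (hx : (φ z).1.charpoly.IsRoot x) : IsAlgebraic (ZMod p) x := by
  by_contra htr
  have hinj : Function.Injective (aeval (R := ZMod p) x) := transcendental_iff_injective.1 htr
  -- Transcendence of `x` makes it a free variable, which can be specialised to a root of `g`.
  let : Algebra (ZMod p)[X] L := (aeval (R := ZMod p) x).toRingHom.toAlgebra
  have : FaithfulSMul (ZMod p)[X] L := (faithfulSMul_iff_algebraMap_injective _ _).2 hinj
  obtain ⟨S, hS⟩ := exists_finset_forall_exists_lift_generalLinearGroup φ
  let A := Algebra.adjoin (ZMod p)[X] (S : Set L)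
  have hA : A.FG := ⟨S, rfl⟩
  have hAf : Algebra.FiniteType (ZMod p)[X] A := (Subalgebra.fg_iff_finiteType A).1 hA
  have hZ : Algebra.FiniteType ℤ (ZMod p) := Algebra.FiniteType.of_surjective
    (Algebra.ofId ℤ (ZMod p)) (ZMod.ringHom_surjective _)
  have hR : Algebra.FiniteType ℤ (ZMod p)[X] := Algebra.FiniteType.trans hZ inferInstance
  have hAZ : Algebra.FiniteType ℤ A := Algebra.FiniteType.trans hR hAf
  obtain ⟨ψ, hψ⟩ := hS A A.val.toRingHom Subtype.val_injective
    fun s hs => ⟨⟨s, Algebra.subset_adjoin hs⟩, rfl⟩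
  obtain ⟨f, hf0, hf⟩ := hA.exists_dvd_pow_of_isUnit
  obtain ⟨q, g, hq, hqN, hg, hgf, hgX, hg1⟩ :=
    ZMod.exists_irreducible_dvd_X_pow_sub_one hf0 hfi.index_ne_zero
  have hgA : ¬ IsUnit (algebraMap (ZMod p)[X] A g) := fun h => by
    obtain ⟨M, hM⟩ := hf g h
    exact hgf (hg.prime.dvd_of_dvd_pow hM)
  obtain ⟨𝔪, h𝔪, hg𝔪⟩ := exists_max_ideal_of_mem_nonunits hgA
  have hpA : (p : A) = 0 := by
    have : (p : (ZMod p)[X]) = 0 := CharP.cast_eq_zero _ p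
    rw [← map_natCast (algebraMap (ZMod p)[X] A), this, map_zero]
  have hfin := Ideal.finite_quotient_of_finiteType_int hp.out 𝔪 (hpA ▸ 𝔪.zero_mem)
  let : Field (A ⧸ 𝔪) := Ideal.Quotient.field 𝔪
  let F := (Matrix.GeneralLinearGroup.map (n := Fin n) (Ideal.Quotient.mk 𝔪)).comp ψ
  have : Finite (GL (Fin n) (A ⧸ 𝔪)) := inferInstance
  let ρ : (ZMod p)[X] →+* A ⧸ 𝔪 := (Ideal.Quotient.mk 𝔪).comp (algebraMap (ZMod p)[X] A)
  have hρg : ρ g = 0 := Ideal.Quotient.eq_zero_iff_mem.2 hg𝔪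
  have hpow : ρ X ^ q = 1 := by
    obtain ⟨c, hc⟩ := hgX
    have := congrArg ρ hc
    rw [map_mul, hρg, zero_mul, map_sub, map_pow, map_one] at this
    exact sub_eq_zero.1 this
  have hne : ρ X ≠ 1 := by
    intro h
    -- If `X` became 1, then `g` would become the nonzero constant `g(1)`.
    obtain ⟨c, hc⟩ := X_sub_C_dvd_sub_C_eval (a := (1 : ZMod p)) (p := g)
    have := congrArg ρ hc
    rw [map_mul, map_sub, map_sub, h, map_one, map_one, sub_self, zero_mul, hρg, zero_sub,
      neg_eq_zero] at this
    exact hg1 ((map_eq_zero (ρ.comp C)).1 this)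
  have hqq := Fact.mk hq
  have hord : orderOf (ρ X) = q := orderOf_eq_prime hpow hne
  have hroot : (F z).1.charpoly.IsRoot (ρ X) := by
    have h1 : (ψ z).1.charpoly.IsRoot (algebraMap (ZMod p)[X] A X) := by
      refine IsRoot.of_map (f := A.val.toRingHom) ?_ Subtype.val_injective
      rw [← Matrix.charpoly_map]
      have h2 : A.val.toRingHom (algebraMap (ZMod p)[X] A X) = x := aeval_X x
      rw [h2]
      rw [← hψ] at hx
      exact hx
    have h3 := h1.map (f := Ideal.Quotient.mk 𝔪)
    rw [← Matrix.charpoly_map] at h3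
    exact h3
  have hd : ρ X ^ orderOf (F z) = 1 := Matrix.pow_eq_one_of_isRoot_charpoly hroot (by
    rw [← Units.val_pow_eq_pow_val, pow_orderOf_eq_one, Units.val_one])
  exact hN.not_dvd_orderOf F hq hqN hz (hord ▸ orderOf_dvd_of_pow_eq_one hd)

open Polynomial in
/-- In characteristic `p`, an invertible matrix with algebraic eigenvalues has finite order. -/
theorem Matrix.GeneralLinearGroup.isOfFinOrder_of_isAlgebraic {n : ℕ} {L : Type*} [Field L]
    [IsAlgClosed L] {p : ℕ} [hp : Fact p.Prime] [Algebra (ZMod p) L] (M : GL (Fin n) L)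
    (hM : ∀ x, M.1.charpoly.IsRoot x → IsAlgebraic (ZMod p) x) : IsOfFinOrder M := by
  classical
  have : CharP L p := charP_of_injective_algebraMap (algebraMap (ZMod p) L).injective p
  have hfo : ∀ x, M.1.charpoly.IsRoot x → IsOfFinOrder x := by
    intro x hx
    have hx0 : x ≠ 0 := by
      rintro rfl
      rw [← Matrix.mem_spectrum_iff_isRoot_charpoly] at hx
      exact spectrum.zero_notMem L M.isUnit hx
    let E := IntermediateField.adjoin (ZMod p) {x}
    have : FiniteDimensional (ZMod p) E :=
      IntermediateField.adjoin.finiteDimensional (hM x hx).isIntegral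
    have : Finite E := Module.finite_of_finite (ZMod p)
    let y : E := ⟨x, IntermediateField.mem_adjoin_simple_self _ x⟩
    have hy : IsOfFinOrder y := (IsUnit.mk0 y fun h => hx0 (congrArg Subtype.val h)).isOfFinOrder
    exact (algebraMap E L).toMonoidHom.isOfFinOrder hy
  let e := ∏ x ∈ M.1.charpoly.roots.toFinset, orderOf x
  have hcp0 : M.1.charpoly ≠ 0 := (Matrix.charpoly_monic _).ne_zero
  have he : 0 < e := Finset.prod_pos fun x hx =>
    (hfo x (isRoot_of_mem_roots (Multiset.mem_toFinset.1 hx))).orderOf_pos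
  have hroot : ∀ x ∈ M.1.charpoly.roots, X - C x ∣ (X ^ e - 1 : L[X]) := by
    intro x hx
    rw [dvd_iff_isRoot]
    have : x ^ e = 1 := orderOf_dvd_iff_pow_eq_one.1
      (Finset.dvd_prod_of_mem (fun x => orderOf x) (Multiset.mem_toFinset.2 hx))
    simp [this]
  have hdvd : M.1.charpoly ∣ (X ^ e - 1 : L[X]) ^ n := by
    have hs := (IsAlgClosed.splits M.1.charpoly).eq_prod_roots_of_monic (Matrix.charpoly_monic _)
    have hcard : M.1.charpoly.roots.card = n := by
      rw [← (IsAlgClosed.splits M.1.charpoly).natDegree_eq_card_roots,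
        Matrix.charpoly_natDegree_eq_dim, Fintype.card_fin]
    have := Multiset.prod_dvd_prod_of_dvd (S := M.1.charpoly.roots) (fun x => X - C x)
      (fun _ => (X ^ e - 1 : L[X])) hroot
    rw [Multiset.map_const', Multiset.prod_replicate, hcard, ← hs] at this
    exact this
  -- Since `n ≤ p ^ n`, Frobenius turns the `n`-th power into a single polynomial `X ^ d - 1`,
  -- absorbing the unipotent part.
  have hdvd' : M.1.charpoly ∣ (X ^ (e * p ^ n) - 1 : L[X]) := by
    refine hdvd.trans ((pow_dvd_pow _ (Nat.lt_pow_self hp.out.one_lt).le).trans ?_)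
    rw [sub_pow_char_pow, one_pow, ← pow_mul]
  obtain ⟨c, hc⟩ := hdvd'
  have h := congrArg (aeval M.1) hc
  rw [map_mul, Matrix.aeval_self_charpoly, zero_mul, map_sub, map_pow, aeval_X, map_one,
    sub_eq_zero] at h
  exact isOfFinOrder_iff_pow_eq_one.2
    ⟨e * p ^ n, Nat.mul_pos he (pow_pos hp.out.pos n), Units.ext (by simpa using h)⟩

/-- In a finitely generated linear group, the verbal subgroup of a word with a marginal subgroup of
finite index is torsion. -/
theorem IsMarginal.isOfFinOrder_of_mem_verbalSubgroup [Group.FG Γ] [N.FiniteIndex]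
    (hN : IsMarginal w N) {n : ℕ} {L : Type v} [Field L] [IsAlgClosed L] (φ : Γ →* GL (Fin n) L)
    (hφ : Function.Injective φ) {z : Γ} (hz : z ∈ verbalSubgroup w Γ) : IsOfFinOrder z := by
  obtain ⟨p, hL⟩ := CharP.exists L
  rcases CharP.char_is_prime_or_zero L p with hp | rfl
  · have := Fact.mk hp
    let : Algebra (ZMod p) L := ZMod.algebra L p
    exact hφ.isOfFinOrder_iff.1 (Matrix.GeneralLinearGroup.isOfFinOrder_of_isAlgebraic (p := p) _
      fun x hx => hN.isAlgebraic_of_isRoot_charpoly φ hz hx)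
  · have := CharP.charP_to_charZero L
    exact hN.isOfFinOrder_of_charZero φ hφ hz

end Torsion

/-! ### Conclusion. -/

/-- Coset representatives of `N` generate a finitely generated subgroup that already carries every
value of `w`. -/
theorem IsMarginal.finite_verbalSubgroup_of_linear {k : ℕ} {w : FreeGroup (Fin k)} {G : Type*}
    [Group G] {N : Subgroup G} [N.Normal] [N.FiniteIndex] (hN : IsMarginal w N) {n : ℕ}
    {L : Type v} [Field L] [IsAlgClosed L] (φ : G →* GL (Fin n) L) (hφ : Function.Injective φ) :
    Finite (verbalSubgroup w G) := by
  let T : Set G := Set.range fun q : G ⧸ N => q.out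
  let Γ : Subgroup G := Subgroup.closure T
  have hfg : Group.FG Γ := by
    rw [Group.fg_iff_subgroup_fg, Subgroup.fg_iff]
    exact ⟨T, rfl, Set.finite_range _⟩
  have hsup : Γ ⊔ N = ⊤ := by
    refine eq_top_iff.2 fun x _ => ?_
    have h1 : (x : G ⧸ N).out ∈ Γ := Subgroup.subset_closure ⟨x, rfl⟩
    have h2 : (x : G ⧸ N).out⁻¹ * x ∈ N := QuotientGroup.eq.1 (QuotientGroup.out_eq' _)
    have := Subgroup.mul_mem_sup h1 h2
    rwa [mul_inv_cancel_left] at this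
  have hfin : Finite (verbalSubgroup w Γ) :=
    (hN.subgroupOf Γ).finite_verbalSubgroup fun z hz =>
      (hN.subgroupOf Γ).isOfFinOrder_of_mem_verbalSubgroup (φ.comp Γ.subtype)
        (hφ.comp Γ.subtype_injective) hz
  have hle : verbalSubgroup w G ≤ (verbalSubgroup w Γ).map Γ.subtype := by
    refine (Subgroup.closure_le _).2 ?_
    rintro _ ⟨g, rfl⟩
    obtain ⟨r, hr, h⟩ := hN.exists_lift_eq hsup g
    refine ⟨FreeGroup.lift (fun i => (⟨r i, hr i⟩ : Γ)) w, Subgroup.subset_closure ⟨_, rfl⟩, ?_⟩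
    rw [← map_lift_apply]
    exact h.symm
  have : Finite ((verbalSubgroup w Γ).map Γ.subtype) :=
    (Set.toFinite ((verbalSubgroup w Γ : Set Γ))).image Γ.subtype
  exact Finite.of_injective _ (Subgroup.inclusion_injective hle)

theorem corollary1p2 {k : ℕ} (w : FreeGroup (Fin k)) :
    StronglyConcise w profiniteLinearGroups.{u, v} := by
  rintro G ⟨F, _, n, φ, hφ⟩ hw
  -- Over the algebraic closure characteristic polynomials split, as the positive characteristic
  -- case requires.
  let ι : GL (Fin n) F →* GL (Fin n) (AlgebraicClosure F) :=
    Matrix.GeneralLinearGroup.map (algebraMap F (AlgebraicClosure F))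
  have hι : Function.Injective ι := by
    intro x y hxy
    ext i j
    apply (algebraMap F (AlgebraicClosure F)).injective
    simpa [ι] using congrArg (fun M : GL (Fin n) (AlgebraicClosure F) => M.1 i j) hxy
  obtain ⟨N, hN⟩ := exists_isMarginal_openNormalSubgroup w hw φ hφ
  have : (N : Subgroup G).FiniteIndex := N.toOpenSubgroup.finiteIndex_of_finite_quotient
  exact hN.finite_verbalSubgroup_of_linear (ι.comp φ) (hι.comp hφ)
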